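/- Let $E$ be a Polish space with Borel $\sigma$-algebra $\mathcal E$, and let $d$ be a bounded metric on $E$ (not necessarily complete, and not necessarily generating the topology of $E$) such that $d:E\times E\to[0,\infty)$ is continuous with respect to the given topology. Let $X=(X_n)_{n\ge 0}$ be a Markov chain in $E$ with transition probability $P(x,dy)$ and $n$-step transition probabilities $P_n(x,dy)$ (with $P_0(x,\cdot)=\delta_x$), and let $\mathbb P_x$ denote the law of the chain started at $x$ on the trajectory space $E^\infty=E^{\{0,1,2,\dots\}}$ with the product $\sigma$-algebra. For probability measures $\nu_1,\nu_2$ on a measurable space $S$, let $C(\nu_1,\nu_2)$ be the set of probability measures $\xi$ on $S\times S$ with marginals $\pi_1(\xi)=\nu_1$, $\pi_2(\xi)=\nu_2$; let $\widehat C(\nu_1,\nu_2)$ be the set of those $\xi$ with $\pi_1(\xi)\ll\nu_1$ and $\pi_2(\xi)\ll\nu_2$; and, for $p>1$ and $R\ge 1$, let $\widehat C^R_p(\nu_1,\nu_2)$ be the set of $\xi\in\widehat C(\nu_1,\nu_2)$ with $$\Big(\int_S\Big(\frac{d\pi_i(\xi)}{d\nu_i}\Big)^p d\nu_i\Big)^{1/p}\le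 R,\qquad i=1,2.$$ For probability measures $\nu_1,\nu_2$ on $E$ put $d(\nu_1,\nu_2)=\inf_{\eta\in C(\nu_1,\nu_2)}\int_{E\times E} d(x,y)\,\eta(dx,dy)$. Assume that $X$ is an e-chain with respect to $d$: for every $x\in E$ and $\varepsilon>0$ there is $\delta>0$ such that $d(P_n(x,\cdot),P_n(y,\cdot))\le\varepsilon$ for all $n\ge 0$ and all $y\in E$ with $d(x,y)<\delta$. Let $\mu$ be an invariant probability measure for $X$, let $M\in\mathcal E\otimes\mathcal E$ satisfy $(\mu\otimes\mu)(M)=1$, and assume that one of the following three conditions holds for every $(x,y)\in M$, where $(X_n)$ and $(Y_n)$ denote the two coordinate trajectories on $E^\infty\times E^\infty$: (i) $\displaystyle\lim_{\varepsilon\downarrow 0}\ \liminf_{n\to\infty}\ \sup_{\xi\in C(\mathbb P_x,\mathbb P_y)}\xi\big(d(X_n,Y_n)\le\varepsilon\big)>0$; (ii) for some $p>1$ and $R\ge 1$ (which may depend on $(x,y)$), $\displaystyle\lim_{\varepsilon\downarrow 0}\ \liminf_{n\to\infty}\ \sup_{\xi\in\widehat C^R_p(\mathbb P_x,\mathbb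 P_y)}\xi\big(d(X_n,Y_n)\le\varepsilon\big)>0$; (iii) $\displaystyle\sup_{\xi\in\widehat C(\mathbb P_x,\mathbb P_y)}\ \lim_{\varepsilon\downarrow 0}\ \liminf_{n\to\infty}\ \xi\big(d(X_n,Y_n)\le\varepsilon\big)>0$. Then, for $\mu$-almost every $x\in E$, $P_n(x,\cdot)$ converges weakly to $\mu$ with respect to $d$; that is, $\int f(y)\,P_n(x,dy)\to\int f\,d\mu$ as $n\to\infty$ for every bounded $d$-continuous function $f:E\to\mathbb R$. -/

import Mathlib

open MeasureTheory ProbabilityTheory Filter Topology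
open scoped ENNReal

namespace GenCoupling

/-- `d` is a metric on the set `E`. (It is kept apart from the topology that `E` carries.) -/
structure IsMetric {E : Type*} (d : E → E → ℝ) : Prop where
  eq_zero_iff : ∀ x y, d x y = 0 ↔ x = y
  symm : ∀ x y, d x y = d y x
  triangle : ∀ x y z, d x z ≤ d x y + d y z

/-- Continuity of a real function with respect to the metric `d`. -/
def DContinuous {E : Type*} (d : E → E → ℝ) (f : E → ℝ) : Prop :=
  ∀ x, ∀ ε > 0, ∃ δ > 0, ∀ y, d x y < δ → |f y - f x| < ε

section Couplings

variable {S : Type*} [MeasurableSpace S]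

/-- Couplings of `μ` and `ν`: probability measures on `S × S` with marginals `μ` and `ν`. -/
def couplings (μ ν : Measure S) : Set (Measure (S × S)) :=
  {ξ | IsProbabilityMeasure ξ ∧ ξ.fst = μ ∧ ξ.snd = ν}

/-- Generalized couplings of `μ` and `ν`: probability measures on `S × S` whose marginals are
absolutely continuous with respect to `μ` and `ν`. -/
def genCouplings (μ ν : Measure S) : Set (Measure (S × S)) :=
  {ξ | IsProbabilityMeasure ξ ∧ ξ.fst ≪ μ ∧ ξ.snd ≪ ν}

/-- Generalized couplings for which the densities of the marginals have `L^p`-norm at most `R`. -/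
noncomputable def genCouplingsLp (p R : ℝ) (μ ν : Measure S) : Set (Measure (S × S)) :=
  {ξ | ξ ∈ genCouplings μ ν ∧
    (∫⁻ s, (ξ.fst.rnDeriv μ s) ^ p ∂μ) ^ (1 / p) ≤ ENNReal.ofReal R ∧
    (∫⁻ s, (ξ.snd.rnDeriv ν s) ^ p ∂ν) ^ (1 / p) ≤ ENNReal.ofReal R}

/-- The minimal (coupling, Kantorovich–Rubinshtein) distance between `μ` and `ν` induced by `d`. -/
noncomputable def couplingDist (d : S → S → ℝ) (μ ν : Measure S) : ℝ≥0∞ :=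
  ⨅ η ∈ couplings μ ν, ∫⁻ z, ENNReal.ofReal (d z.1 z.2) ∂η

end Couplings

section Chain

variable {E : Type*} [MeasurableSpace E]

/-- The law of the next state given the history up to time `n`, for the Markov chain with
transition probability `P`: it is `P` applied to the last state. -/
noncomputable def stepKernel (P : Kernel E E) (n : ℕ) :
    Kernel ((i : Finset.Iic n) → (fun _ : ℕ => E) i) E :=
  P.comap (fun h => h ⟨n, Finset.mem_Iic.2 le_rfl⟩) (measurable_pi_apply _)

instance (P : Kernel E E) [IsMarkovKernel P] (n : ℕ) : IsMarkovKernel (stepKernel P n) := by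
  unfold stepKernel; infer_instance

/-- The law on the trajectory space `ℕ → E` of the Markov chain with transition probability `P`
started at `x`. -/
noncomputable def pathLaw (P : Kernel E E) [IsMarkovKernel P] (x : E) : Measure (ℕ → E) :=
  Kernel.traj (X := fun _ : ℕ => E) (stepKernel P) 0 (fun _ => x)

/-- The set of pairs of trajectories which are at `d`-distance at most `ε` at time `n`. -/
def closeAt (d : E → E → ℝ) (n : ℕ) (ε : ℝ) : Set ((ℕ → E) × (ℕ → E)) :=
  {z | d (z.1 n) (z.2 n) ≤ ε}

/-- The e-chain property: the `n`-step transition probabilities `P ^ n` (iterated composition of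
kernels, `P ^ 0 = id`) are equicontinuous with respect to `d`. -/
def IsEChain (d : E → E → ℝ) (P : Kernel E E) : Prop :=
  ∀ x, ∀ ε : ℝ, 0 < ε → ∃ δ : ℝ, 0 < δ ∧ ∀ n : ℕ, ∀ y, d x y < δ →
    couplingDist d ((P ^ n) x) ((P ^ n) y) ≤ ENNReal.ofReal ε

/-- `lim_{ε ↓ 0} F ε`. For monotone `F` (the only case used) this limit exists,
see `tendsto_limZero`. -/
noncomputable def limZero (F : ℝ → ℝ≥0∞) : ℝ≥0∞ := limUnder (𝓝[>] (0 : ℝ)) F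

theorem tendsto_limZero {F : ℝ → ℝ≥0∞} (hF : Monotone F) :
    Tendsto F (𝓝[>] 0) (𝓝 (limZero F)) :=
  tendsto_nhds_limUnder ⟨_, hF.tendsto_nhdsGT 0⟩

theorem limZero_eq_sInf {F : ℝ → ℝ≥0∞} (hF : Monotone F) :
    limZero F = sInf (F '' Set.Ioi 0) :=
  (hF.tendsto_nhdsGT 0).limUnder_eq

/-- `lim_{ε ↓ 0} liminf_n sup_ξ ξ(d(X_n, Y_n) ≤ ε) > 0`, supremum over all couplings. -/
def CondI (d : E → E → ℝ) (P : Kernel E E) [IsMarkovKernel P] (x y : E) : Prop :=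
  0 < limZero fun ε => liminf
    (fun n => ⨆ ξ ∈ couplings (pathLaw P x) (pathLaw P y), ξ (closeAt d n ε)) atTop

/-- For some `p > 1`, `R ≥ 1`, `lim_{ε ↓ 0} liminf_n sup_ξ ξ(d(X_n, Y_n) ≤ ε) > 0`, supremum over
all generalized couplings with densities bounded by `R` in `L^p`. -/
def CondII (d : E → E → ℝ) (P : Kernel E E) [IsMarkovKernel P] (x y : E) : Prop :=
  ∃ p R : ℝ, 1 < p ∧ 1 ≤ R ∧ 0 < limZero fun ε => liminf
    (fun n => ⨆ ξ ∈ genCouplingsLp p R (pathLaw P x) (pathLaw P y), ξ (closeAt d n ε)) atTop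

/-- `sup_ξ lim_{ε ↓ 0} liminf_n ξ(d(X_n, Y_n) ≤ ε) > 0`, supremum over all generalized
couplings. -/
def CondIII (d : E → E → ℝ) (P : Kernel E E) [IsMarkovKernel P] (x y : E) : Prop :=
  0 < ⨆ ξ ∈ genCouplings (pathLaw P x) (pathLaw P y),
    limZero fun ε => liminf (fun n => ξ (closeAt d n ε)) atTop

/-- Weak convergence with respect to `d`: convergence of the integrals of all bounded
`d`-continuous functions. -/
def WeakTendsto (d : E → E → ℝ) (ν : ℕ → Measure E) (μ : Measure E) : Prop :=
  ∀ f : E → ℝ, DContinuous d f → (∃ C, ∀ x, |f x| ≤ C) →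
    Tendsto (fun n => ∫ y, f y ∂(ν n)) atTop (𝓝 (∫ y, f y ∂μ))

end Chain

end GenCoupling

/-! Test against bounded `d`-Lipschitz f and put g_n = P^n f. The e-chain property makes (g_n)
equicontinuous, so along one subsequence φ all shifts g_{φ(k)-j} converge pointwise, to functions
h_j with P^n h_n = h_0. By Jensen and invariance the L²(μ)-norms of the g_n decrease, so all h_n
have the same norm. Thus P^n loses no norm on h_n, which forces h_n(X_n) = h_0(x) almost surely for
μ-a.e. starting point x (`ae_eq_const_of_integral_sq_eq`).

Almost sure identities survive absolutely continuous changes of the marginals, so under a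
generalized coupling h_n(X_n) = h_0(x) and h_n(Y_n) = h_0(y). These values nearly agree when X_n and
Y_n are close and X_n lies where the family h has a uniform modulus of continuity; by Fatou, X_n
lies there with probability near one for infinitely many n (`UniformlyCoupled.eq_of_ae_eq`). Hence
h_0 is a.e. constant, g_n tends to ∫ f dμ in L²(μ), and equicontinuity upgrades this to pointwise
convergence on the support of μ. -/

namespace GenCoupling

/-! ### Equicontinuity with respect to `d` and Arzelà–Ascoli -/

section Metric

variable {E : Type*} {d : E → E → ℝ}

theorem IsMetric.self (hd : IsMetric d) (x : E) : d x x = 0 := (hd.eq_zero_iff x x).2 rfl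

theorem IsMetric.nonneg (hd : IsMetric d) (x y : E) : 0 ≤ d x y := by
  have h := hd.triangle x y x
  rw [hd.self, hd.symm y x] at h
  linarith

/-- Equicontinuity of a family of real functions with respect to the metric `d`. -/
def DEquicontinuous {ι : Type*} (d : E → E → ℝ) (h : ι → E → ℝ) : Prop :=
  ∀ x, ∀ ε > 0, ∃ δ > 0, ∀ y, d x y < δ → ∀ i, |h i y - h i x| ≤ ε

variable [TopologicalSpace E]

theorem isOpen_dball (hc : Continuous fun z : E × E => d z.1 z.2) (x : E) (r : ℝ) :
    IsOpen {y | d x y < r} :=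
  isOpen_lt (hc.comp (Continuous.prodMk_right x)) continuous_const

/-- Continuity of `d` makes the `d`-topology coarser than the given one. This is what makes `d`-open
sets Borel although `d` need not generate the topology. -/
theorem isOpen_of_forall_dball (hd : IsMetric d) (hc : Continuous fun z : E × E => d z.1 z.2)
    {U : Set E} (hU : ∀ x ∈ U, ∃ δ > 0, ∀ y, d x y < δ → y ∈ U) : IsOpen U := by
  refine isOpen_iff_mem_nhds.2 fun x hx => ?_
  obtain ⟨δ, hδ, h⟩ := hU x hx
  exact mem_of_superset ((isOpen_dball hc x δ).mem_nhds (by simpa [hd.self] using hδ)) h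

theorem DEquicontinuous.continuous {ι : Type*} {h : ι → E → ℝ} (hh : DEquicontinuous d h)
    (hd : IsMetric d) (hc : Continuous fun z : E × E => d z.1 z.2) (i : ι) :
    Continuous (h i) := by
  refine continuous_iff_continuousAt.2 fun x => Metric.tendsto_nhds.2 fun ε hε => ?_
  obtain ⟨δ, hδ, H⟩ := hh x (ε / 2) (by positivity)
  filter_upwards [(isOpen_dball hc x δ).mem_nhds (by simpa [hd.self] using hδ)] with y hy
  have := H y hy i
  rw [Real.dist_eq]
  linarith

/-- A pointwise bounded equicontinuous sequence has a subsequence `φ` along which all the shifted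
sequences `g (φ k - j)` converge pointwise. -/
theorem DEquicontinuous.exists_subseq [TopologicalSpace.SeparableSpace E] {g : ℕ → E → ℝ}
    (hg : DEquicontinuous d g) (hd : IsMetric d) (hc : Continuous fun z : E × E => d z.1 z.2)
    {C : ℝ} (hC : ∀ n x, |g n x| ≤ C) :
    ∃ φ : ℕ → ℕ, StrictMono φ ∧ ∃ h : ℕ → E → ℝ,
      ∀ j x, Tendsto (fun k => g (φ k - j) x) atTop (𝓝 (h j x)) := by
  rcases isEmpty_or_nonempty E with hE | hE
  · exact ⟨id, strictMono_id, fun _ _ => 0, fun _ x => isEmptyElim x⟩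
  -- One coordinate for each pair (shift, point of a dense sequence): compactness of a countable
  -- product replaces a diagonal argument and handles all shifts at once.
  let u : ℕ → ℕ × ℕ → ℝ := fun n p => g (n - p.1) (TopologicalSpace.denseSeq E p.2)
  have hcomp : IsCompact (Set.univ.pi fun _ : ℕ × ℕ => Set.Icc (-C) C) :=
    isCompact_univ_pi fun _ => isCompact_Icc
  obtain ⟨a, -, φ, hφ, hlim⟩ := hcomp.tendsto_subseq (x := u)
    fun n p _ => abs_le.1 (hC _ _)
  rw [tendsto_pi_nhds] at hlim
  have key : ∀ j x, ∃ l, Tendsto (fun k => g (φ k - j) x) atTop (𝓝 l) := by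
    intro j x
    refine cauchySeq_tendsto_of_complete (Metric.cauchySeq_iff'.2 fun ε hε => ?_)
    obtain ⟨δ, hδ, H⟩ := hg x (ε / 4) (by positivity)
    obtain ⟨i, hi⟩ := (TopologicalSpace.denseRange_denseSeq E).exists_mem_open
      (isOpen_dball hc x δ) ⟨x, by simpa [hd.self] using hδ⟩
    obtain ⟨N, hN⟩ := Metric.cauchySeq_iff'.1 (hlim (j, i)).cauchySeq (ε / 4) (by positivity)
    refine ⟨N, fun n hn => ?_⟩
    have h1 := H _ hi (φ n - j)
    have h2 := H _ hi (φ N - j)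
    have h3 : |g (φ n - j) (TopologicalSpace.denseSeq E i)
        - g (φ N - j) (TopologicalSpace.denseSeq E i)| < ε / 4 := hN n hn
    rw [Real.dist_eq]
    rw [abs_le] at h1 h2
    rw [abs_lt] at h3 ⊢
    constructor <;> linarith
  choose h hh using key
  exact ⟨φ, hφ, h, hh⟩

end Metric

/-! ### Integrals, coupling distance and weak convergence -/

section Integral

variable {E : Type*} [MeasurableSpace E] {d : E → E → ℝ}

theorem integrable_of_abs_le {ν : Measure E} [IsFiniteMeasure ν] {f : E → ℝ} (hf : Measurable f)
    {C : ℝ} (hC : ∀ x, |f x| ≤ C) : Integrable f ν :=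
  .of_bound hf.aestronglyMeasurable C (.of_forall hC)

theorem memLp_of_abs_le {ν : Measure E} [IsFiniteMeasure ν] {f : E → ℝ} (hf : Measurable f)
    {C : ℝ} (hC : ∀ x, |f x| ≤ C) (p : ℝ≥0∞) : MemLp f p ν :=
  .of_bound hf.aestronglyMeasurable C (.of_forall hC)

theorem abs_integral_le_of_abs_le {ν : Measure E} [IsProbabilityMeasure ν] {f : E → ℝ}
    {C : ℝ} (hC : ∀ x, |f x| ≤ C) : |∫ x, f x ∂ν| ≤ C := by
  simpa using norm_integral_le_of_norm_le_const (μ := ν) (f := f) (.of_forall hC)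

/-- The easy half of the Kantorovich–Rubinshtein duality. -/
theorem abs_integral_sub_le_of_couplingDist_le (hd : ∀ x y, 0 ≤ d x y)
    (hdm : Measurable fun z : E × E => d z.1 z.2) {ν₁ ν₂ : Measure E} {f : E → ℝ}
    (hf : Measurable f) {C : ℝ} (hC : ∀ x, |f x| ≤ C) {L : ℝ} (hL : 0 ≤ L)
    (hfL : ∀ x y, |f x - f y| ≤ L * d x y) {e : ℝ} (he : 0 ≤ e)
    (h : couplingDist d ν₁ ν₂ ≤ ENNReal.ofReal e) :
    |∫ x, f x ∂ν₁ - ∫ x, f x ∂ν₂| ≤ L * e := by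
  -- The infimum over couplings need not be attained, so a near-optimal coupling is used for each e'
  -- > e, and then e' ↓ e.
  have key : ∀ e' > e, |∫ x, f x ∂ν₁ - ∫ x, f x ∂ν₂| ≤ L * e' := by
    intro e' he'
    have hlt : couplingDist d ν₁ ν₂ < ENNReal.ofReal e' :=
      h.trans_lt ((ENNReal.ofReal_lt_ofReal_iff (he.trans_lt he')).2 he')
    simp only [couplingDist, iInf_lt_iff] at hlt
    obtain ⟨η, ⟨hη, rfl, rfl⟩, hlt⟩ := hlt
    have hint : Integrable (fun z : E × E => d z.1 z.2) η := by
      refine ⟨hdm.aestronglyMeasurable, ?_⟩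
      rw [hasFiniteIntegral_iff_ofReal (.of_forall fun z => hd _ _)]
      exact hlt.trans ENNReal.ofReal_lt_top
    have hle : ∫ z, d z.1 z.2 ∂η ≤ e' := by
      rw [integral_eq_lintegral_of_nonneg_ae (.of_forall fun z => hd _ _)
        hdm.aestronglyMeasurable]
      exact ENNReal.toReal_le_of_le_ofReal (he.trans he'.le) hlt.le
    have h1 : Integrable (fun z : E × E => f z.1) η :=
      integrable_of_abs_le (hf.comp measurable_fst) fun z => hC z.1
    have h2 : Integrable (fun z : E × E => f z.2) η :=
      integrable_of_abs_le (hf.comp measurable_snd) fun z => hC z.2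
    rw [Measure.fst, Measure.snd,
      integral_map measurable_fst.aemeasurable hf.aestronglyMeasurable,
      integral_map measurable_snd.aemeasurable hf.aestronglyMeasurable, ← integral_sub h1 h2]
    calc |∫ z : E × E, (f z.1 - f z.2) ∂η| ≤ ∫ z : E × E, |f z.1 - f z.2| ∂η :=
          abs_integral_le_integral_abs
      _ ≤ ∫ z : E × E, L * d z.1 z.2 ∂η :=
          integral_mono (h1.sub h2).abs (hint.const_mul L) fun z => hfL _ _
      _ = L * ∫ z, d z.1 z.2 ∂η := integral_const_mul _ _
      _ ≤ L * e' := by gcongr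
  have hlim : Tendsto (fun e' => L * e') (𝓝[>] e) (𝓝 (L * e)) :=
    ((continuous_const.mul continuous_id).tendsto e).mono_left nhdsWithin_le_nhds
  exact ge_of_tendsto hlim (eventually_mem_nhdsWithin.mono key)

/-- Bounded Lipschitz functions determine weak convergence with respect to `d`. -/
theorem weakTendsto_of_lipschitz (hd : IsMetric d)
    (hmeas : ∀ U : Set E, (∀ x ∈ U, ∃ δ > 0, ∀ y, d x y < δ → y ∈ U) → MeasurableSet U)
    {ν : ℕ → Measure E} [∀ n, IsProbabilityMeasure (ν n)] {μ : Measure E} [IsProbabilityMeasure μ]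
    (h : ∀ f : E → ℝ, (∃ C, ∀ x, |f x| ≤ C) → (∃ L, 0 ≤ L ∧ ∀ x y, |f x - f y| ≤ L * d x y) →
      Tendsto (fun n => ∫ y, f y ∂(ν n)) atTop (𝓝 (∫ y, f y ∂μ))) :
    WeakTendsto d ν μ := by
  intro f hf hfb
  let _ : PseudoMetricSpace E :=
    { dist := d
      dist_self := hd.self
      dist_comm := hd.symm
      dist_triangle := hd.triangle }
  have hO : OpensMeasurableSpace E := by
    refine ⟨MeasurableSpace.generateFrom_le fun U (hU : IsOpen U) => hmeas U fun x hx => ?_⟩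
    obtain ⟨δ, hδ, H⟩ := Metric.isOpen_iff.1 hU x hx
    exact ⟨δ, hδ, fun y hy => H (by rw [Metric.mem_ball, dist_comm]; exact hy)⟩
  have hfc : Continuous f := by
    refine Metric.continuous_iff.2 fun x ε hε => ?_
    obtain ⟨δ, hδ, H⟩ := hf x ε hε
    exact ⟨δ, hδ, fun y hy => H y (by rw [dist_comm] at hy; exact hy)⟩
  obtain ⟨C, hC⟩ := hfb
  let F : BoundedContinuousFunction E ℝ := BoundedContinuousFunction.ofNormedAddCommGroup f hfc C hC
  let νs : ℕ → ProbabilityMeasure E := fun n => ⟨ν n, inferInstance⟩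
  let μs : ProbabilityMeasure E := ⟨μ, inferInstance⟩
  have hT : Tendsto νs atTop (𝓝 μs) := by
    refine tendsto_iff_forall_lipschitz_integral_tendsto.2 ?_
    rintro g ⟨K, hK⟩ ⟨L, hL⟩
    refine h g ?_ ⟨L, L.2, fun x y => ?_⟩
    · rcases isEmpty_or_nonempty E with hE | ⟨⟨x₀⟩⟩
      · exact ⟨0, fun x => isEmptyElim x⟩
      · refine ⟨|g x₀| + K, fun x => ?_⟩
        have h1 := hK x x₀
        rw [Real.dist_eq] at h1
        have h2 := abs_sub_abs_le_abs_sub (g x) (g x₀)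
        linarith
    · exact hL.dist_le_mul x y
  exact ProbabilityMeasure.tendsto_iff_forall_integral_tendsto.1 hT F

end Integral

theorem abs_sq_le {α : Type*} {g : α → ℝ} {C : ℝ} (hC : ∀ x, |g x| ≤ C) (x : α) :
    |g x ^ 2| ≤ C ^ 2 := by
  rw [abs_pow]
  exact pow_le_pow_left₀ (abs_nonneg _) (hC x) 2

/-! ### Iterates of the kernel and the invariant measure -/

section Iterate

variable {E : Type*} [MeasurableSpace E]

theorem integral_sub_integral_sq {ν : Measure E} [IsProbabilityMeasure ν] {g : E → ℝ}
    (hg : Measurable g) {C : ℝ} (hC : ∀ x, |g x| ≤ C) :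
    ∫ y, (g y - ∫ z, g z ∂ν) ^ 2 ∂ν = ∫ y, g y ^ 2 ∂ν - (∫ y, g y ∂ν) ^ 2 := by
  rw [← variance_eq_integral hg.aemeasurable, variance_eq_sub (memLp_of_abs_le hg hC 2)]
  rfl

theorem sq_integral_le {ν : Measure E} [IsProbabilityMeasure ν] {g : E → ℝ}
    (hg : Measurable g) {C : ℝ} (hC : ∀ x, |g x| ≤ C) :
    (∫ y, g y ∂ν) ^ 2 ≤ ∫ y, g y ^ 2 ∂ν := by
  have h : 0 ≤ ∫ y, (g y - ∫ z, g z ∂ν) ^ 2 ∂ν := integral_nonneg fun _ => sq_nonneg _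
  rw [integral_sub_integral_sq hg hC] at h
  linarith

theorem measurable_integral_kernel (κ : Kernel E E) [IsMarkovKernel κ] {g : E → ℝ}
    (hg : Measurable g) : Measurable fun x => ∫ y, g y ∂κ x :=
  (hg.stronglyMeasurable.integral_kernel).measurable

instance isMarkovKernel_pow (P : Kernel E E) [IsMarkovKernel P] (n : ℕ) :
    IsMarkovKernel (P ^ n) := by
  induction n with
  | zero => exact inferInstanceAs (IsMarkovKernel Kernel.id)
  | succ n ih => rw [pow_succ]; exact inferInstanceAs (IsMarkovKernel ((P ^ n) ∘ₖ P))

theorem invariant_pow {P : Kernel E E} {μ : Measure E} (h : Kernel.Invariant P μ) (n : ℕ) :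
    Kernel.Invariant (P ^ n) μ := by
  induction n with
  | zero => exact Measure.id_comp
  | succ n ih => rw [pow_succ]; exact ih.comp h

theorem integral_integral_of_invariant {κ : Kernel E E} [IsMarkovKernel κ] {μ : Measure E}
    [IsProbabilityMeasure μ] (h : Kernel.Invariant κ μ) {g : E → ℝ} (hg : Measurable g) {C : ℝ}
    (hC : ∀ x, |g x| ≤ C) : ∫ x, ∫ y, g y ∂κ x ∂μ = ∫ x, g x ∂μ := by
  have hi : Integrable g ((κ ∘ₖ Kernel.const Unit μ) ()) := integrable_of_abs_le hg hC
  have h2 := Kernel.integral_comp hi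
  rw [Kernel.comp_const, h.def, Kernel.const_apply] at h2
  exact h2.symm

theorem integral_pow_add (P : Kernel E E) [IsMarkovKernel P] {g : E → ℝ} (hg : Measurable g)
    {C : ℝ} (hC : ∀ x, |g x| ≤ C) (m n : ℕ) (x : E) :
    ∫ y, g y ∂(P ^ (m + n)) x = ∫ z, ∫ y, g y ∂(P ^ m) z ∂(P ^ n) x := by
  have hi : Integrable g (((P ^ m) ∘ₖ (P ^ n)) x) := integrable_of_abs_le hg hC
  rw [← Kernel.integral_comp hi, Kernel.pow_add]

/-- If `P ^ n` maps `h n` to `h 0` without loss of `L²`-norm, then `h n` is almost surely constant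
under the `n`-step transition probabilities. -/
theorem ae_eq_const_of_integral_sq_eq {P : Kernel E E} [IsMarkovKernel P] {μ : Measure E}
    [IsProbabilityMeasure μ] (hμ : Kernel.Invariant P μ) {h : ℕ → E → ℝ}
    (hm : ∀ n, Measurable (h n)) {C : ℝ} (hC : ∀ n x, |h n x| ≤ C)
    (hP : ∀ n x, ∫ y, h n y ∂(P ^ n) x = h 0 x)
    (hs : ∀ n, ∫ x, h n x ^ 2 ∂μ = ∫ x, h 0 x ^ 2 ∂μ) :
    ∀ᵐ x ∂μ, ∀ n, ∀ᵐ y ∂(P ^ n) x, h n y = h 0 x := by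
  refine ae_all_iff.2 fun n => ?_
  have hV : ∀ x, ∫ y, (h n y - h 0 x) ^ 2 ∂(P ^ n) x
      = ∫ y, h n y ^ 2 ∂(P ^ n) x - h 0 x ^ 2 := by
    intro x
    have := integral_sub_integral_sq (ν := (P ^ n) x) (hm n) (hC n)
    rwa [hP] at this
  have hi1 : Integrable (fun x => ∫ y, h n y ^ 2 ∂(P ^ n) x) μ :=
    integrable_of_abs_le (measurable_integral_kernel _ ((hm n).pow_const 2))
      fun x => abs_integral_le_of_abs_le (abs_sq_le (hC n))
  have hi2 : Integrable (fun x => h 0 x ^ 2) μ :=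
    integrable_of_abs_le ((hm 0).pow_const 2) (abs_sq_le (hC 0))
  -- The conditional variance of h_n(X_n) has μ-mean zero, hence vanishes for almost every starting
  -- point.
  have h0 : ∫ x, ∫ y, (h n y - h 0 x) ^ 2 ∂(P ^ n) x ∂μ = 0 := by
    simp_rw [hV]
    rw [integral_sub hi1 hi2, integral_integral_of_invariant (invariant_pow hμ n)
      ((hm n).pow_const 2) (abs_sq_le (hC n)), hs, sub_self]
  have hi : Integrable (fun x => ∫ y, (h n y - h 0 x) ^ 2 ∂(P ^ n) x) μ := by
    simp_rw [hV]
    exact hi1.sub hi2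
  rw [integral_eq_zero_iff_of_nonneg (fun x => integral_nonneg fun _ => sq_nonneg _) hi] at h0
  filter_upwards [h0] with x hx
  rw [Pi.zero_apply, integral_eq_zero_iff_of_nonneg (fun _ => sq_nonneg _)] at hx
  · filter_upwards [hx] with y hy
    exact sub_eq_zero.1 (pow_eq_zero_iff two_ne_zero |>.1 hy)
  · have hb : ∀ y, |h n y - h 0 x| ≤ C + C := fun y =>
      (abs_sub _ _).trans (add_le_add (hC n y) (hC 0 x))
    exact integrable_of_abs_le (((hm n).sub_const _).pow_const 2) (abs_sq_le hb)

/-- For almost every starting point, the chain returns infinitely often, with probability close to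
one, to the members of an exhausting sequence of sets. -/
theorem ae_exists_frequently_pow_compl_lt {P : Kernel E E} [IsMarkovKernel P] {μ : Measure E}
    [IsProbabilityMeasure μ] (hμ : Kernel.Invariant P μ) {A : ℕ → Set E}
    (hA : ∀ j, MeasurableSet (A j)) (hmono : Monotone A) (hU : ⋃ j, A j = Set.univ) :
    ∀ᵐ x ∂μ, ∀ β > 0, ∃ j, ∃ᶠ n in atTop, (P ^ n) x (A j)ᶜ < β := by
  let u : ℕ → E → ℝ≥0∞ := fun j x => liminf (fun n => (P ^ n) x (A j)ᶜ) atTop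
  have hum : ∀ j, Measurable (u j) := fun j =>
    .liminf fun n => Kernel.measurable_coe _ (hA j).compl
  -- Fatou's lemma, where invariance makes every term of the sequence equal to the μ-measure of the
  -- complement.
  have hle : ∀ j, ∫⁻ x, u j x ∂μ ≤ μ (A j)ᶜ := by
    intro j
    refine (lintegral_liminf_le fun n => Kernel.measurable_coe _ (hA j).compl).trans ?_
    have : ∀ n, ∫⁻ x, (P ^ n) x (A j)ᶜ ∂μ = μ (A j)ᶜ := by
      intro n
      rw [← Measure.bind_apply (hA j).compl (Kernel.aemeasurable _), (invariant_pow hμ n).def]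
    simp [this]
  have hlim : Tendsto (fun j => μ (A j)ᶜ) atTop (𝓝 0) := by
    have := tendsto_measure_iInter_atTop (μ := μ) (s := fun j => (A j)ᶜ)
      (fun j => (hA j).compl.nullMeasurableSet)
      (fun i j hij => Set.compl_subset_compl.2 (hmono hij)) ⟨0, measure_ne_top _ _⟩
    rwa [← Set.compl_iUnion, hU, Set.compl_univ, measure_empty] at this
  have h0 : ∫⁻ x, ⨅ j, u j x ∂μ = 0 := by
    refine le_antisymm (ge_of_tendsto' hlim fun j => ?_) (zero_le)
    exact (lintegral_mono fun x => iInf_le _ j).trans (hle j)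
  rw [lintegral_eq_zero_iff (.iInf hum)] at h0
  filter_upwards [h0] with x hx β hβ
  obtain ⟨j, hj⟩ := iInf_lt_iff.1 (hx.trans_lt hβ)
  exact ⟨j, frequently_lt_of_liminf_lt (by isBoundedDefault) hj⟩

end Iterate

/-! ### One-dimensional marginals of the trajectory law -/

section PathLaw

variable {E : Type*} [MeasurableSpace E] (P : Kernel E E) [IsMarkovKernel P] (x : E)

instance : IsProbabilityMeasure (pathLaw P x) := by
  unfold pathLaw; infer_instance

/-- Induction on time: the kernel for the next state sees only the last coordinate of the history,
so each step composes with `P`. This transfers statements on transition probabilities to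
trajectories. -/
theorem pathLaw_map_eval (n : ℕ) : (pathLaw P x).map (fun z => z n) = (P ^ n) x := by
  have key : ((Kernel.traj (X := fun _ : ℕ => E) (stepKernel P) 0).map fun z => z n)
      = (P ^ n).comap (fun h => h ⟨0, Finset.mem_Iic.2 le_rfl⟩) (measurable_pi_apply _) := by
    induction n with
    | zero =>
      have h := Kernel.traj_map_frestrictLe (X := fun _ : ℕ => E) (κ := stepKernel P) 0 0
      rw [Kernel.partialTraj_self] at h
      have h2 : (fun z : ℕ → E => z 0) =
          (fun h : (i : Finset.Iic 0) → E => h ⟨0, Finset.mem_Iic.2 le_rfl⟩)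
            ∘ Preorder.frestrictLe 0 := rfl
      rw [h2, Kernel.map_comp_right _ (Preorder.measurable_frestrictLe 0) (measurable_pi_apply _), h,
        pow_zero,
        Kernel.id_map (by fun_prop)]
      ext a s hs
      rw [Kernel.comap_apply]
      rfl
    | succ n ih =>
      have h1 : (stepKernel P n) ∘ₖ Kernel.partialTraj (X := fun _ : ℕ => E) (stepKernel P) 0 n
          = P ∘ₖ (Kernel.partialTraj (X := fun _ : ℕ => E) (stepKernel P) 0 n).map
            (fun h => h ⟨n, Finset.mem_Iic.2 le_rfl⟩) :=
        (Kernel.comp_map _ _ (measurable_pi_apply _)).symm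
      rw [← Kernel.traj_comp_partialTraj (Nat.zero_le n), Kernel.map_comp,
        Kernel.map_traj_succ_self, h1, ← Kernel.traj_map_frestrictLe,
        ← Kernel.map_comp_right _ (Preorder.measurable_frestrictLe n) (measurable_pi_apply _)]
      change P ∘ₖ ((Kernel.traj (X := fun _ : ℕ => E) (stepKernel P) 0).map fun z => z n) = _
      rw [ih, ← Kernel.comp_deterministic_eq_comap, ← Kernel.comp_assoc,
        Kernel.comp_deterministic_eq_comap, pow_succ']
      rfl
  rw [pathLaw, ← Kernel.map_apply _ (by fun_prop), key, Kernel.comap_apply]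

end PathLaw

theorem closeAt_mono {E : Type*} (d : E → E → ℝ) (n : ℕ) : Monotone (closeAt d n) :=
  fun _ _ h _ hz => le_trans hz h

/-! ### Reduction of the three conditions to one, and the coupling argument -/

section UniformlyCoupled

variable {E : Type*} [MeasurableSpace E] {d : E → E → ℝ} {P : Kernel E E} [IsMarkovKernel P]
  {x y : E}

/-- A common consequence of the three coupling conditions: generalized couplings, with uniformly
absolutely continuous first marginals, under which the two chains are close to each other with
probability bounded below. -/
def UniformlyCoupled (d : E → E → ℝ) (P : Kernel E E) [IsMarkovKernel P] (x y : E) : Prop :=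
  ∃ α > 0, ∃ β > 0, ∀ ε > 0, ∀ᶠ n in atTop, ∃ ξ ∈ genCouplings (pathLaw P x) (pathLaw P y),
    α < ξ (closeAt d n ε) ∧ ∀ A, MeasurableSet A → pathLaw P x A < β → ξ.fst A ≤ α

theorem exists_lt_of_limZero_pos {F : ℝ → ℝ≥0∞} (hF : Monotone F) (h : 0 < limZero F) :
    ∃ α > 0, ∀ ε > 0, α < F ε := by
  obtain ⟨α, hα, hα'⟩ := exists_between h
  rw [limZero_eq_sInf hF] at hα'
  exact ⟨α, hα, fun ε hε => hα'.trans_le (sInf_le ⟨ε, hε, rfl⟩)⟩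

theorem monotone_liminf_iSup_closeAt (d : E → E → ℝ) (S : Set (Measure ((ℕ → E) × (ℕ → E)))) :
    Monotone fun ε => liminf (fun n => ⨆ ξ ∈ S, ξ (closeAt d n ε)) atTop :=
  fun _ _ h => liminf_le_liminf (.of_forall fun n =>
    iSup₂_mono fun _ _ => measure_mono (closeAt_mono d n h))

/-- The sup-type conditions give uniform coupling, once the couplings in question have uniformly
absolutely continuous first marginals. -/
theorem uniformlyCoupled_of_limZero_pos {S : Set (Measure ((ℕ → E) × (ℕ → E)))}
    (hS : S ⊆ genCouplings (pathLaw P x) (pathLaw P y))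
    (hunif : ∀ α > 0, ∃ β > 0, ∀ ξ ∈ S, ∀ A, MeasurableSet A → pathLaw P x A < β → ξ.fst A ≤ α)
    (h : 0 < limZero fun ε => liminf (fun n => ⨆ ξ ∈ S, ξ (closeAt d n ε)) atTop) :
    UniformlyCoupled d P x y := by
  obtain ⟨α, hα, H⟩ := exists_lt_of_limZero_pos (monotone_liminf_iSup_closeAt d S) h
  obtain ⟨β, hβ, Hβ⟩ := hunif α hα
  refine ⟨α, hα, β, hβ, fun ε hε => ?_⟩
  filter_upwards [eventually_lt_of_lt_liminf (H ε hε)] with n hn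
  simp only [lt_iSup_iff] at hn
  obtain ⟨ξ, hξ, hlt⟩ := hn
  exact ⟨ξ, hS hξ, hlt, Hβ ξ hξ⟩

/-- The first marginal is the path law itself, so β = α works. -/
theorem CondI.uniformlyCoupled (h : CondI d P x y) : UniformlyCoupled d P x y := by
  refine uniformlyCoupled_of_limZero_pos ?_ (fun α hα => ⟨α, hα, ?_⟩) h
  · rintro ξ ⟨h1, h2, h3⟩
    exact ⟨h1, h2 ▸ .rfl, h3 ▸ .rfl⟩
  · rintro ξ ⟨-, h2, -⟩ A - hA
    exact h2 ▸ hA.le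

/-- Measures with densities bounded in `L^p` are uniformly absolutely continuous. -/
theorem measure_le_of_lintegral_rnDeriv_rpow_le {S : Type*} [MeasurableSpace S] {ν ρ : Measure S}
    [IsProbabilityMeasure ν] [IsProbabilityMeasure ρ] (hac : ρ ≪ ν) {p q : ℝ}
    (hpq : p.HolderConjugate q) {R : ℝ≥0∞}
    (hR : (∫⁻ s, (ρ.rnDeriv ν s) ^ p ∂ν) ^ (1 / p) ≤ R) {A : Set S} (hA : MeasurableSet A) :
    ρ A ≤ R * ν A ^ (1 / q) := by
  have h1 : ∫⁻ s, (A.indicator (fun _ => (1 : ℝ≥0∞)) s) ^ q ∂ν = ν A := by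
    rw [← lintegral_indicator_one hA]
    congr with s
    by_cases hs : s ∈ A
    · simp [hs]
    · simp [hs, hpq.symm.pos]
  calc ρ A = ∫⁻ s in A, ρ.rnDeriv ν s ∂ν := (Measure.setLIntegral_rnDeriv hac A).symm
    _ = ∫⁻ s, (ρ.rnDeriv ν * A.indicator fun _ => (1 : ℝ≥0∞)) s ∂ν := by
        rw [← lintegral_indicator hA]
        congr with s
        by_cases hs : s ∈ A <;> simp [hs]
    _ ≤ (∫⁻ s, (ρ.rnDeriv ν s) ^ p ∂ν) ^ (1 / p)
          * (∫⁻ s, (A.indicator (fun _ => (1 : ℝ≥0∞)) s) ^ q ∂ν) ^ (1 / q) :=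
        ENNReal.lintegral_mul_le_Lp_mul_Lq ν hpq (Measure.measurable_rnDeriv _ _).aemeasurable
          (measurable_const.indicator hA).aemeasurable
    _ ≤ R * ν A ^ (1 / q) := by rw [h1]; gcongr

theorem CondII.uniformlyCoupled (h : CondII d P x y) : UniformlyCoupled d P x y := by
  obtain ⟨p, R, hp, hR, h⟩ := h
  refine uniformlyCoupled_of_limZero_pos (fun ξ hξ => hξ.1) (fun α hα => ?_) h
  have hpq := Real.HolderConjugate.conjExponent hp
  set q := p.conjExponent
  have hR0 : ENNReal.ofReal R ≠ 0 := by
    simpa using (zero_lt_one.trans_le hR)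
  -- Chosen so that Hölder's bound R · β^(1/q) equals α.
  refine ⟨(α / ENNReal.ofReal R) ^ q, ENNReal.rpow_pos_of_nonneg
    (ENNReal.div_pos hα.ne' ENNReal.ofReal_ne_top) hpq.symm.nonneg, ?_⟩
  rintro ξ ⟨⟨hξ, h1, -⟩, hL, -⟩ A hA hlt
  refine (measure_le_of_lintegral_rnDeriv_rpow_le h1 hpq hL hA).trans ?_
  have h2 : (pathLaw P x A) ^ (1 / q) ≤ α / ENNReal.ofReal R := by
    rw [one_div, ENNReal.rpow_inv_le_iff hpq.symm.pos]
    exact hlt.le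
  calc ENNReal.ofReal R * pathLaw P x A ^ (1 / q)
      ≤ ENNReal.ofReal R * (α / ENNReal.ofReal R) := by gcongr
    _ = α := ENNReal.mul_div_cancel hR0 ENNReal.ofReal_ne_top

/-- A single generalized coupling suffices here, and uniform absolute continuity is that of the
integral of one integrable density. -/
theorem CondIII.uniformlyCoupled (h : CondIII d P x y) : UniformlyCoupled d P x y := by
  obtain ⟨ξ, h⟩ := lt_iSup_iff.1 h
  obtain ⟨hξ, h⟩ := lt_iSup_iff.1 h
  obtain ⟨hprob, hac, -⟩ := id hξ
  refine uniformlyCoupled_of_limZero_pos (S := {ξ}) (by simpa using hξ) (fun α hα => ?_)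
    (by simpa using h)
  have hfin : ∫⁻ s, ξ.fst.rnDeriv (pathLaw P x) s ∂(pathLaw P x) ≠ ∞ :=
    (Measure.lintegral_rnDeriv_lt_top _ _).ne
  obtain ⟨β, hβ, H⟩ := exists_pos_setLIntegral_lt_of_measure_lt hfin hα.ne'
  refine ⟨β, hβ, ?_⟩
  rintro _ rfl A - hA
  have := H A hA
  rw [Measure.setLIntegral_rnDeriv hac] at this
  exact this.le

/-- Functions that are almost surely constant along the chain and equicontinuous take the same
value at the starting points of uniformly coupled chains. -/
theorem UniformlyCoupled.eq_of_ae_eq (hxy : UniformlyCoupled d P x y) {h : ℕ → E → ℝ}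
    (hx : ∀ n, ∀ᵐ z ∂(P ^ n) x, h n z = h 0 x) (hy : ∀ n, ∀ᵐ z ∂(P ^ n) y, h n z = h 0 y)
    {A : ℕ → ℕ → Set E} (hA : ∀ m j, MeasurableSet (A m j))
    (hAh : ∀ m j, ∀ z ∈ A m j, ∀ w, d z w < 1 / ((j : ℝ) + 1) →
      ∀ n, |h n w - h n z| ≤ 1 / ((m : ℝ) + 1))
    (hret : ∀ m, ∀ β > 0, ∃ j, ∃ᶠ n in atTop, (P ^ n) x (A m j)ᶜ < β) :
    h 0 x = h 0 y := by
  obtain ⟨α, -, β, hβ, H⟩ := hxy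
  have key : ∀ m : ℕ, |h 0 y - h 0 x| ≤ 1 / ((m : ℝ) + 1) := by
    intro m
    by_contra hcon
    obtain ⟨j, hj⟩ := hret m β hβ
    -- Half the scale, because closeness is a non-strict inequality while the oscillation sets use a
    -- strict one.
    have hpos : (0 : ℝ) < 1 / ((j : ℝ) + 1) / 2 := by positivity
    obtain ⟨n, hn, ξ, ⟨hprob, hfst, hsnd⟩, hlt, hξ⟩ := (hj.and_eventually (H _ hpos)).exists
    have hx' : ∀ᵐ z ∂ξ, h n (z.1 n) = h 0 x := by
      have := hx n
      rw [← pathLaw_map_eval] at this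
      exact ae_of_ae_map measurable_fst.aemeasurable
        (hfst.ae_le (ae_of_ae_map (measurable_pi_apply n).aemeasurable this))
    have hy' : ∀ᵐ z ∂ξ, h n (z.2 n) = h 0 y := by
      have := hy n
      rw [← pathLaw_map_eval] at this
      exact ae_of_ae_map measurable_snd.aemeasurable
        (hsnd.ae_le (ae_of_ae_map (measurable_pi_apply n).aemeasurable this))
    have hmeas : MeasurableSet {z : ℕ → E | z n ∈ (A m j)ᶜ} :=
      measurable_pi_apply n (hA m j).compl
    have hsmall : pathLaw P x {z : ℕ → E | z n ∈ (A m j)ᶜ} < β := by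
      rw [← pathLaw_map_eval, Measure.map_apply (measurable_pi_apply n) (hA m j).compl] at hn
      exact hn
    have hle := hξ _ hmeas hsmall
    rw [Measure.fst_apply hmeas] at hle
    -- If the values differ by more than 1/(m+1), closeness forces X_n out of `A m j`, so α <
    -- ξ(close) ≤ ξ(X_n ∉ A m j) ≤ α.
    refine absurd (hlt.trans_le ((measure_mono_ae ?_).trans hle)) (lt_irrefl _)
    filter_upwards [hx', hy'] with z hzx hzy hz
    by_contra hzA
    have hzA' : z.1 n ∈ A m j := not_not.1 hzA
    have hz' : d (z.1 n) (z.2 n) ≤ 1 / ((j : ℝ) + 1) / 2 := hz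
    have := hAh m j _ hzA' (z.2 n) (by linarith) n
    rw [hzx, hzy] at this
    exact hcon this
  have h0 : |h 0 y - h 0 x| ≤ 0 :=
    ge_of_tendsto' tendsto_one_div_add_atTop_nhds_zero_nat key
  linarith [abs_nonpos_iff.1 h0]

end UniformlyCoupled

/-! ### Sets of small oscillation -/

section SmallOscillation

variable {E : Type*} {d : E → E → ℝ}

/-- The points at which an equicontinuous family oscillates by at most `ε` on the `d`-ball of
radius `δ`. -/
def smallOscSet {ι : Type*} (d : E → E → ℝ) (h : ι → E → ℝ) (ε δ : ℝ) : Set E :=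
  {x | ∀ y, d x y < δ → ∀ i, |h i y - h i x| ≤ ε}

theorem monotone_smallOscSet {ι : Type*} (h : ι → E → ℝ) (ε : ℝ) :
    Monotone fun j : ℕ => smallOscSet d h ε (1 / ((j : ℝ) + 1)) :=
  fun _ _ hij _ hx y hy => hx y (hy.trans_le (one_div_le_one_div_of_le (by positivity)
    (by gcongr)))

theorem DEquicontinuous.iUnion_smallOscSet {ι : Type*} {h : ι → E → ℝ} (hh : DEquicontinuous d h)
    {ε : ℝ} (hε : 0 < ε) : ⋃ j : ℕ, smallOscSet d h ε (1 / ((j : ℝ) + 1)) = Set.univ := by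
  refine Set.eq_univ_of_forall fun x => Set.mem_iUnion.2 ?_
  obtain ⟨δ, hδ, H⟩ := hh x ε hε
  obtain ⟨j, hj⟩ := exists_nat_one_div_lt hδ
  exact ⟨j, fun y hy => H y (hy.trans hj)⟩

/-- Closedness supplies measurability, which the uncountable intersection over y would not give by
itself. -/
theorem isClosed_smallOscSet [TopologicalSpace E]
    (hc : Continuous fun z : E × E => d z.1 z.2) {ι : Type*} {h : ι → E → ℝ} (hh : ∀ i, Continuous (h i)) (ε δ : ℝ) :
    IsClosed (smallOscSet d h ε δ) := by
  have : smallOscSet d h ε δ = ⋂ y, ⋂ i, {x | d x y < δ → |h i y - h i x| ≤ ε} := by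
    ext x
    simp only [smallOscSet, Set.mem_ofPred_eq, Set.mem_iInter]
    exact forall_congr' fun y => forall_comm
  rw [this]
  exact isClosed_iInter fun y => isClosed_iInter fun i =>
    isClosed_imp (isOpen_lt (hc.comp (Continuous.prodMk_left y)) continuous_const)
      (isClosed_le (continuous_const.sub (hh i)).abs continuous_const)

end SmallOscillation

/-! ### Convergence of the iterates -/

section Convergence

variable {E : Type*} [TopologicalSpace E] [MeasurableSpace E] [BorelSpace E] {d : E → E → ℝ}
  {P : Kernel E E} {μ : Measure E} [IsProbabilityMeasure μ]

theorem IsEChain.dEquicontinuous [SecondCountableTopology E] (hP : IsEChain d P) (hd : IsMetric d)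
    (hc : Continuous fun z : E × E => d z.1 z.2) {f : E → ℝ} (hf : Measurable f) {C : ℝ}
    (hC : ∀ x, |f x| ≤ C) {L : ℝ} (hL : 0 ≤ L) (hfL : ∀ x y, |f x - f y| ≤ L * d x y) :
    DEquicontinuous d fun n x => ∫ y, f y ∂(P ^ n) x := by
  intro x ε hε
  -- Dividing by L + 1 rather than L allows L = 0.
  obtain ⟨δ, hδ, H⟩ := hP x (ε / (L + 1)) (by positivity)
  refine ⟨δ, hδ, fun y hy n => ?_⟩
  rw [abs_sub_comm]
  refine (abs_integral_sub_le_of_couplingDist_le hd.nonneg hc.measurable hf hC hL hfL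
    (by positivity) (H n y hy)).trans ?_
  rw [mul_div_assoc', div_le_iff₀ (by positivity)]
  nlinarith

/-- `L²`-convergence of the iterates, along with equicontinuity, gives pointwise convergence on the
support of the invariant measure. -/
theorem DEquicontinuous.tendsto_of_tendsto_integral_sq (hd : IsMetric d)
    (hc : Continuous fun z : E × E => d z.1 z.2) {g : ℕ → E → ℝ} (hg : DEquicontinuous d g)
    {C : ℝ} (hC : ∀ n x, |g n x| ≤ C) {m : ℝ}
    (hlim : Tendsto (fun n => ∫ x, (g n x - m) ^ 2 ∂μ) atTop (𝓝 0)) {x : E} (hx : x ∈ μ.support) :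
    Tendsto (fun n => g n x) atTop (𝓝 m) := by
  refine Metric.tendsto_nhds.2 fun ε hε => ?_
  obtain ⟨δ, hδ, H⟩ := hg x (ε / 2) (by positivity)
  set U := {y | d x y < δ}
  have hUo : IsOpen U := isOpen_dball hc x δ
  have hU : 0 < μ.real U := by
    refine ENNReal.toReal_pos ?_ (measure_ne_top _ _)
    exact ((Measure.mem_support_iff_forall x).1 hx U
      (hUo.mem_nhds (by simpa [U, hd.self] using hδ))).ne'
  -- If g_n(x) is at least ε away from m, equicontinuity keeps g_n at least ε/2 away on all of U,
  -- which contributes this much to the integral.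
  filter_upwards [hlim.eventually_lt_const (u := (ε / 2) ^ 2 * μ.real U) (by positivity)] with n hn
  by_contra hcon
  rw [Real.dist_eq, not_lt] at hcon
  refine absurd hn (not_lt.2 ?_)
  have hgm : Measurable (g n) := (hg.continuous hd hc n).measurable
  have hb : ∀ y, |g n y - m| ≤ C + |m| := fun y => (abs_sub _ _).trans (by gcongr; exact hC n y)
  have hi : Integrable (fun y => (g n y - m) ^ 2) μ :=
    integrable_of_abs_le ((hgm.sub_const _).pow_const 2) (abs_sq_le hb)
  calc (ε / 2) ^ 2 * μ.real U = ∫ _ in U, (ε / 2) ^ 2 ∂μ := by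
        rw [setIntegral_const, smul_eq_mul, mul_comm]
    _ ≤ ∫ y in U, (g n y - m) ^ 2 ∂μ := by
        refine setIntegral_mono_on (integrable_const _).integrableOn hi.integrableOn
          hUo.measurableSet fun y hy => ?_
        rw [← sq_abs (g n y - m)]
        have h1 := H y hy n
        have h2 := abs_sub_le (g n x) (g n y) m
        rw [abs_sub_comm] at h1
        exact pow_le_pow_left₀ (by positivity) (by linarith) 2
    _ ≤ ∫ y, (g n y - m) ^ 2 ∂μ :=
        setIntegral_le_integral hi (.of_forall fun _ => sq_nonneg _)

theorem tendsto_integral_pow_of_lipschitz [SecondCountableTopology E] [IsMarkovKernel P]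
    (hd : IsMetric d)
    (hc : Continuous fun z : E × E => d z.1 z.2) (hP : IsEChain d P)
    (hμ : Kernel.Invariant P μ) (hcoup : ∀ᵐ z ∂μ.prod μ, UniformlyCoupled d P z.1 z.2)
    {f : E → ℝ} {C : ℝ} (hC : ∀ x, |f x| ≤ C) {L : ℝ} (hL : 0 ≤ L)
    (hfL : ∀ x y, |f x - f y| ≤ L * d x y) {x : E} (hx : x ∈ μ.support) :
    Tendsto (fun n => ∫ y, f y ∂(P ^ n) x) atTop (𝓝 (∫ y, f y ∂μ)) := by
  have hfeq : DEquicontinuous d fun _ : Unit => f := by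
    intro x ε hε
    refine ⟨ε / (L + 1), by positivity, fun y hy _ => ?_⟩
    rw [abs_sub_comm]
    refine (hfL x y).trans ?_
    rw [lt_div_iff₀ (by positivity)] at hy
    nlinarith [hd.nonneg x y]
  have hf : Measurable f := (hfeq.continuous hd hc ()).measurable
  set g : ℕ → E → ℝ := fun n x => ∫ y, f y ∂(P ^ n) x with hg_def
  have hg : DEquicontinuous d g := hP.dEquicontinuous hd hc hf hC hL hfL
  have hgC : ∀ n x, |g n x| ≤ C := fun n x => abs_integral_le_of_abs_le hC
  have hgm : ∀ n, Measurable (g n) := fun n => measurable_integral_kernel _ hf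
  have hgadd : ∀ n j x, ∫ y, g n y ∂(P ^ j) x = g (n + j) x := fun n j x =>
    (integral_pow_add P hf hC n j x).symm
  have hgint : ∀ n, ∫ x, g n x ∂μ = ∫ x, f x ∂μ := fun n =>
    integral_integral_of_invariant (invariant_pow hμ n) hf hC
  obtain ⟨φ, hφ, h, hh⟩ := hg.exists_subseq hd hc hgC
  have hhC : ∀ n x, |h n x| ≤ C := fun n x =>
    le_of_tendsto' (hh n x).abs fun k => hgC _ _
  have hheq : DEquicontinuous d h := by
    intro x ε hε
    obtain ⟨δ, hδ, H⟩ := hg x ε hε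
    exact ⟨δ, hδ, fun y hy n => le_of_tendsto' ((hh n y).sub (hh n x)).abs fun k => H y hy _⟩
  have hhc := hheq.continuous hd hc
  have hhm : ∀ n, Measurable (h n) := fun n => (hhc n).measurable
  have hφj : ∀ j, Tendsto (fun k => φ k - j) atTop atTop := fun j =>
    (tendsto_sub_atTop_nat j).comp hφ.tendsto_atTop
  have hhP : ∀ n x, ∫ y, h n y ∂(P ^ n) x = h 0 x := by
    intro n x
    have h1 : Tendsto (fun k => ∫ y, g (φ k - n) y ∂(P ^ n) x) atTop
        (𝓝 (∫ y, h n y ∂(P ^ n) x)) :=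
      tendsto_integral_of_dominated_convergence (fun _ => C)
        (fun k => (hgm _).aestronglyMeasurable) (integrable_const _)
        (fun k => .of_forall fun y => hgC _ y) (.of_forall fun y => hh n y)
    refine tendsto_nhds_unique h1 ((hh 0 x).congr' ?_)
    -- The subtraction is truncated, so the semigroup identity holds only once φ(k) ≥ n.
    filter_upwards [hφ.tendsto_atTop.eventually_ge_atTop n] with k hk
    rw [hgadd, Nat.sub_add_cancel hk, Nat.sub_zero]
  set V : ℕ → ℝ := fun n => ∫ x, g n x ^ 2 ∂μ with hV_def
  have hVanti : Antitone V := by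
    refine antitone_nat_of_succ_le fun n => ?_
    have hi : Integrable (fun x => g (n + 1) x ^ 2) μ :=
      integrable_of_abs_le ((hgm _).pow_const 2) (abs_sq_le (hgC _))
    have hi2 : Integrable (fun x => ∫ y, g n y ^ 2 ∂(P ^ 1) x) μ :=
      integrable_of_abs_le (measurable_integral_kernel _ ((hgm n).pow_const 2))
        fun x => abs_integral_le_of_abs_le (abs_sq_le (hgC n))
    calc V (n + 1) ≤ ∫ x, ∫ y, g n y ^ 2 ∂(P ^ 1) x ∂μ := by
          refine integral_mono hi hi2 fun x => ?_
          have := sq_integral_le (ν := (P ^ 1) x) (hgm n) (hgC n)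
          rwa [hgadd] at this
      _ = V n := integral_integral_of_invariant (invariant_pow hμ 1) ((hgm n).pow_const 2)
          (abs_sq_le (hgC n))
  obtain ⟨s, hs⟩ : ∃ s, Tendsto V atTop (𝓝 s) :=
    ⟨_, tendsto_atTop_ciInf hVanti ⟨0, by
      rintro _ ⟨n, rfl⟩
      exact integral_nonneg fun _ => sq_nonneg _⟩⟩
  -- V converges along the whole sequence, so shifting the subsequence does not change the limit.
  have hhs : ∀ n, ∫ x, h n x ^ 2 ∂μ = s := by
    intro n
    have h1 : Tendsto (fun k => ∫ y, g (φ k - n) y ^ 2 ∂μ) atTop (𝓝 (∫ y, h n y ^ 2 ∂μ)) :=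
      tendsto_integral_of_dominated_convergence (fun _ => C ^ 2)
        (fun k => ((hgm _).pow_const 2).aestronglyMeasurable) (integrable_const _)
        (fun k => .of_forall fun y => abs_sq_le (hgC _) y)
        (.of_forall fun y => (hh n y).pow 2)
    exact tendsto_nhds_unique h1 (hs.comp (hφj n))
  have hh0 : ∫ x, h 0 x ∂μ = ∫ x, f x ∂μ := by
    have h1 : Tendsto (fun k => ∫ y, g (φ k - 0) y ∂μ) atTop (𝓝 (∫ y, h 0 y ∂μ)) :=
      tendsto_integral_of_dominated_convergence (fun _ => C)
        (fun k => (hgm _).aestronglyMeasurable) (integrable_const _)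
        (fun k => .of_forall fun y => hgC _ y) (.of_forall fun y => hh 0 y)
    simp_rw [hgint] at h1
    exact tendsto_nhds_unique h1 tendsto_const_nhds
  have hae := ae_eq_const_of_integral_sq_eq hμ hhm hhC hhP fun n => (hhs n).trans (hhs 0).symm
  have hAmeas : ∀ m j : ℕ,
      MeasurableSet (smallOscSet d h (1 / ((m : ℝ) + 1)) (1 / ((j : ℝ) + 1))) :=
    fun m j => (isClosed_smallOscSet hc hhc _ _).measurableSet
  have hret : ∀ᵐ x ∂μ, ∀ m : ℕ, ∀ β > 0, ∃ j : ℕ, ∃ᶠ n in atTop,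
      (P ^ n) x (smallOscSet d h (1 / ((m : ℝ) + 1)) (1 / ((j : ℝ) + 1)))ᶜ < β :=
    ae_all_iff.2 fun m => ae_exists_frequently_pow_compl_lt hμ (hAmeas m)
      (monotone_smallOscSet h _) (hheq.iUnion_smallOscSet (by positivity))
  have hconst : ∀ᵐ x ∂μ, ∀ᵐ y ∂μ, h 0 x = h 0 y := by
    filter_upwards [Measure.ae_ae_of_ae_prod hcoup, hae, hret] with x hx1 hx2 hx3
    filter_upwards [hx1, hae] with y hy1 hy2
    exact hy1.eq_of_ae_eq hx2 hy2 hAmeas (fun m j z hz => hz) hx3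
  obtain ⟨x₀, hx₀⟩ := hconst.exists
  have hm : h 0 x₀ = ∫ x, f x ∂μ := by
    rw [← hh0, ← integral_congr_ae hx₀]
    simp
  -- A constant limit has second moment equal to its squared mean, so the variances of the g_n tend
  -- to zero.
  have hsm : s = (∫ x, f x ∂μ) ^ 2 := by
    rw [← hm, ← hhs 0, ← integral_congr_ae (f := fun _ => h 0 x₀ ^ 2)
      (hx₀.mono fun y hy => by simp only [hy])]
    simp
  refine hg.tendsto_of_tendsto_integral_sq hd hc hgC (μ := μ) ?_ hx
  have hvar : ∀ n, ∫ x, (g n x - ∫ y, f y ∂μ) ^ 2 ∂μ = V n - (∫ y, f y ∂μ) ^ 2 := by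
    intro n
    have := integral_sub_integral_sq (ν := μ) (hgm n) (hgC n)
    rwa [hgint] at this
  simp_rw [hvar]
  have hlim := hs.sub_const ((∫ y, f y ∂μ) ^ 2)
  rwa [hsm, sub_self] at hlim

end Convergence

end GenCoupling

theorem theorem2p5 {E : Type*} [TopologicalSpace E] [PolishSpace E]
    [MeasurableSpace E] [BorelSpace E]
    (d : E → E → ℝ) (hd : GenCoupling.IsMetric d)
    (hd_bdd : ∃ C : ℝ, ∀ x y, d x y ≤ C)
    (hd_cont : Continuous fun z : E × E => d z.1 z.2)
    (P : Kernel E E) [IsMarkovKernel P]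
    (hP : GenCoupling.IsEChain d P)
    (μ : Measure E) [IsProbabilityMeasure μ] (hμ : Kernel.Invariant P μ)
    (M : Set (E × E)) (hM : MeasurableSet M) (hM1 : (μ.prod μ) M = 1)
    (hcond : (∀ x y, (x, y) ∈ M → GenCoupling.CondI d P x y) ∨
      (∀ x y, (x, y) ∈ M → GenCoupling.CondII d P x y) ∨
      (∀ x y, (x, y) ∈ M → GenCoupling.CondIII d P x y)) :
    ∀ᵐ x ∂μ, GenCoupling.WeakTendsto d (fun n => (P ^ n) x) μ := by
  have hcoup : ∀ z ∈ M, GenCoupling.UniformlyCoupled d P z.1 z.2 := by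
    rintro ⟨x, y⟩ hz
    rcases hcond with h | h | h
    · exact (h x y hz).uniformlyCoupled
    · exact (h x y hz).uniformlyCoupled
    · exact (h x y hz).uniformlyCoupled
  have hMae : ∀ᵐ z ∂μ.prod μ, z ∈ M := mem_ae_iff_prob_eq_one hM |>.2 hM1
  -- The exceptional set is the complement of the support. It is chosen before f, so uncountably
  -- many test functions cause no trouble.
  filter_upwards [Measure.support_mem_ae (μ := μ)] with x hx
  refine GenCoupling.weakTendsto_of_lipschitz hd
    (fun U hU => (GenCoupling.isOpen_of_forall_dball hd hd_cont hU).measurableSet) ?_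
  rintro f ⟨C, hC⟩ ⟨L, hL, hfL⟩
  exact GenCoupling.tendsto_integral_pow_of_lipschitz hd hd_cont hP hμ
    (hMae.mono hcoup) hC hL hfL hx
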